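/- Fix an orthonormal basis $\{|i\rangle\}$ of a finite-dimensional Hilbert space, let $\Delta(X)=\sum_i |i\rangle\langle i|X|i\rangle\langle i|$ be the fully decohering map, and call a density matrix incoherent if it is diagonal in this basis. A channel is a completely positive trace-preserving linear map $\Phi$; it is off-diagonal independent (OI) if $\Phi=\Phi\circ\Delta$. A (time-homogeneous Markovian) dynamics is a family of channels $\Lambda(t)$, indexed by the elements of a commutative semigroup of durations (for instance $t\in\mathbb R_{\ge 0}$ for Lindblad dynamics $\Lambda(t)=e^{t\mathcal L}$, or $t\in\{1,2,\dots\}$ for the iterates of a single channel), with $\Lambda(t+\tau)=\Lambda(t)\circ\Lambda(\tau)$. It is non-coherence-generating-and-detecting (NCGD) if $\Delta\circ\Lambda(t)\circ\Delta\circ\Lambda(\tau)\circ\Delta=\Delta\circ\Lambda(t+\tau)\circ\Delta$ for all $t,\tau$. Let $\Lambda$ be NCGD. Then: (1) The Leggett–Garg inequality holds for all incoherent initial states: let $\rho$ be an incoherent state at time $t_1$, let $t_2-t_1=\tau$ and $t_3-t_2=t$ be arbitrary durations, and let $Q=\sum_i q_i|i\rangle\langle i|$ with all $q_i\in\{1,-1\}$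 be measured by projecting onto the basis vectors $|i\rangle$ and recording $q_i$. Then $C_{12}+C_{23}-C_{13}\le 1$, where $C_{ab}$ is the expectation of the product of the outcomes at $t_a$ and $t_b$ when only these two times are measured. (2) For every $t$ such that $\Lambda(t)$ is not OI there is an incoherent state $\rho$ for which the pseudo-density matrix (PDM) $R$ of $\rho$ and $\Lambda(t)$ is spatially incompatible, that is, not a density matrix, and for which there is a witness: a Hermitian $W$ with $\mathrm{Tr}[W\sigma]\ge 0$ for all density matrices $\sigma$ and $\mathrm{Tr}[WR]<0$. Here, for $n$ qubits with $\{|i\rangle\}$ the computational basis, $R=4^{-n}\sum_{i,j}\langle\{\sigma_i,\sigma_j\}\rangle\,\sigma_i\otimes\sigma_j$, where $\sigma_i,\sigma_j$ run over all $n$-fold tensor products of $\mathbb I,\sigma_x,\sigma_y,\sigma_z$ and $\langle\{\sigma_i,\sigma_j\}\rangle$ is the expectation of the product of the outcomes when the projectors $(\mathbb I\pm\sigma_i)/2$ are measured on $\rho$, the channel is applied, and the projectors $(\mathbb I\pm\sigma_j)/2$ are measured. The same holds in every finite dimension, where $R$ is the operator with $\mathrm{Tr}[R(A\otimes B)]=\langle\{A,B\}\rangle$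 for all Hermitian $B$ and all light-touch $A$ (Hermitian with $A^2=\lambda^2\mathbb I$, $\lambda\ge0$), and $\langle\{A,B\}\rangle$ is the expectation of the product of the outcomes when $A$ is measured on $\rho$ by projecting onto its eigenspaces, the channel is applied, and $B$ is measured. -/

import Mathlib

open scoped Kronecker ComplexOrder

noncomputable section

namespace TemporalQuantum

section States

variable {ι : Type*} [Fintype ι] [DecidableEq ι]

/-- A density matrix: positive semidefinite with unit trace. -/
def IsDensityMatrix (ρ : Matrix ι ι ℂ) : Prop :=
  ρ.PosSemidef ∧ ρ.trace = 1

/-- An incoherent state: a density matrix that is diagonal in the fixed basis. -/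
def IsIncoherentState (ρ : Matrix ι ι ℂ) : Prop :=
  IsDensityMatrix ρ ∧ ρ.IsDiag

/-- The rank-one projector `|i⟩⟨i|` onto the `i`-th vector of the fixed basis. -/
def basisProj (i : ι) : Matrix ι ι ℂ := Matrix.single i i 1

/-- The fully decohering map `Δ(X) = ∑ i, |i⟩⟨i| X |i⟩⟨i|`. -/
def decohere : Matrix ι ι ℂ →ₗ[ℂ] Matrix ι ι ℂ where
  toFun X := Matrix.diagonal X.diag
  map_add' X Y := by
    ext i j
    by_cases h : i = j <;> simp [h]
  map_smul' c X := by
    ext i j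
    by_cases h : i = j <;> simp [h]

end States

section Channels

variable {ι : Type*} [Fintype ι] [DecidableEq ι]

/-- The ampliation `id_k ⊗ Φ`, which applies `Φ` to every block of a `k × k` block matrix. -/
def ampliate (k : ℕ) (Φ : Matrix ι ι ℂ →ₗ[ℂ] Matrix ι ι ℂ)
    (X : Matrix (Fin k × ι) (Fin k × ι) ℂ) : Matrix (Fin k × ι) (Fin k × ι) ℂ :=
  Matrix.of fun p q => Φ (Matrix.of fun a b => X (p.1, a) (q.1, b)) p.2 q.2

/-- Complete positivity: all ampliations `id_k ⊗ Φ` preserve positive semidefiniteness. -/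
def IsCompletelyPositive (Φ : Matrix ι ι ℂ →ₗ[ℂ] Matrix ι ι ℂ) : Prop :=
  ∀ (k : ℕ) (X : Matrix (Fin k × ι) (Fin k × ι) ℂ), X.PosSemidef → (ampliate k Φ X).PosSemidef

/-- A quantum channel: a completely positive trace-preserving linear map. -/
def IsChannel (Φ : Matrix ι ι ℂ →ₗ[ℂ] Matrix ι ι ℂ) : Prop :=
  IsCompletelyPositive Φ ∧ ∀ X, (Φ X).trace = X.trace

/-- Off-diagonal independence of a channel: `Φ = Φ ∘ Δ`. -/
def IsOffDiagonalIndependent (Φ : Matrix ι ι ℂ →ₗ[ℂ] Matrix ι ι ℂ) : Prop :=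
  Φ = Φ ∘ₗ decohere

end Channels

/-- A time-homogeneous Markovian dynamics with set of durations `T`: a channel `Λ(t)` for every
duration `t`, with `Λ(t + τ) = Λ(t) ∘ Λ(τ)`.  For `T = ℝ≥0` every Lindblad dynamics
`Λ(t) = exp(t𝓛)` is of this kind; for `T = ℕ+` these are the iterates of one arbitrary channel. -/
structure Dynamics (T : Type*) [AddCommSemigroup T] (ι : Type*) [Fintype ι] [DecidableEq ι] where
  /-- the channel describing the evolution over the duration `t` -/
  evolve : T → (Matrix ι ι ℂ →ₗ[ℂ] Matrix ι ι ℂ)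
  isChannel : ∀ t, IsChannel (evolve t)
  evolve_add : ∀ t τ, evolve (t + τ) = evolve t ∘ₗ evolve τ

/-- Non-coherence-generating-and-detecting dynamics:
`Δ ∘ Λ(t) ∘ Δ ∘ Λ(τ) ∘ Δ = Δ ∘ Λ(t + τ) ∘ Δ` for all durations. -/
def Dynamics.IsNCGD {T : Type*} [AddCommSemigroup T] {ι : Type*} [Fintype ι] [DecidableEq ι]
    (Λ : Dynamics T ι) : Prop :=
  ∀ t τ : T, decohere ∘ₗ Λ.evolve t ∘ₗ decohere ∘ₗ Λ.evolve τ ∘ₗ decohere =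
    decohere ∘ₗ Λ.evolve (t + τ) ∘ₗ decohere

section LeggettGarg

variable {ι : Type*} [Fintype ι] [DecidableEq ι]

/-- The two-time correlator `⟨{Q, Q}⟩` for a system in state `σ` on which the fixed basis is
measured, then evolved by `Φ`, then measured in the fixed basis again, the outcome `i` being
assigned the value `q i` of the observable `Q = ∑ i, q i |i⟩⟨i|`: it is the sum of `q i * q j` times
the probability `Tr[|j⟩⟨j| Φ(|i⟩⟨i| σ |i⟩⟨i|)]`. -/
def basisCorrelator (q : ι → ℝ) (σ : Matrix ι ι ℂ) (Φ : Matrix ι ι ℂ →ₗ[ℂ] Matrix ι ι ℂ) : ℝ :=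
  ∑ i, ∑ j, q i * q j *
    (basisProj j * Φ (basisProj i * σ * basisProj i)).trace.re

/-- The Leggett–Garg inequality `C₁₂ + C₂₃ - C₁₃ ≤ 1` for the observable `Q = ∑ i, q i |i⟩⟨i|`,
the state `ρ` at the first time, the channel `Φ` from the first to the second time and the channel
`Ψ` from the second to the third.  Each correlator comes from its own experiment, in which only the
two times concerned are measured. -/
def LeggettGargInequality (q : ι → ℝ) (ρ : Matrix ι ι ℂ)
    (Φ Ψ : Matrix ι ι ℂ →ₗ[ℂ] Matrix ι ι ℂ) : Prop :=
  basisCorrelator q ρ Φ + basisCorrelator q (Φ ρ) Ψ - basisCorrelator q ρ (Ψ ∘ₗ Φ) ≤ 1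

end LeggettGarg

section PDM

/-- The Pauli matrices `𝟙, σ_x, σ_y, σ_z`. -/
def pauli : Fin 4 → Matrix (Fin 2) (Fin 2) ℂ :=
  ![!![1, 0; 0, 1], !![0, 1; 1, 0], !![0, -Complex.I; Complex.I, 0], !![1, 0; 0, -1]]

/-- The `n`-qubit Pauli observable `σ_{s 0} ⊗ ⋯ ⊗ σ_{s (n-1)}`, in the computational basis, which
is labelled by bit strings. -/
def pauliString {n : ℕ} (s : Fin n → Fin 4) : Matrix (Fin n → Fin 2) (Fin n → Fin 2) ℂ :=
  Matrix.of fun a b => ∏ k, pauli (s k) (a k) (b k)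

/-- The operator `(𝟙 + ε A) / 2`; for an observable `A` with `A ^ 2 = 1` and `ε = 1` or `ε = -1`
this is the projector onto the eigenspace of `A` with eigenvalue `ε`. -/
def signProj {ι : Type*} [DecidableEq ι] (A : Matrix ι ι ℂ) (ε : ℤˣ) : Matrix ι ι ℂ :=
  (1 / 2 : ℂ) • (1 + ((ε : ℤ) : ℂ) • A)

/-- The two-time correlator of two observables `A`, `B` with eigenvalues `±1`: the system in state
`ρ` is projected onto an eigenspace of `A`, evolved by `Φ`, and projected onto an eigenspace of `B`;
the correlator is the expectation of the product of the outcomes. -/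
def dichotomicCorrelator {ι : Type*} [Fintype ι] [DecidableEq ι] (A B ρ : Matrix ι ι ℂ)
    (Φ : Matrix ι ι ℂ →ₗ[ℂ] Matrix ι ι ℂ) : ℂ :=
  ∑ ε : ℤˣ, ∑ δ : ℤˣ, ((ε : ℤ) : ℂ) * ((δ : ℤ) : ℂ) *
    (signProj B δ * Φ (signProj A ε * ρ * signProj A ε)).trace

/-- The pseudo-density matrix of an `n`-qubit system in state `ρ` evolving by `Φ`:
`R = 4⁻ⁿ ∑ ⟨{σ_i, σ_j}⟩ σ_i ⊗ σ_j`. -/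
def pauliPDM {n : ℕ} (ρ : Matrix (Fin n → Fin 2) (Fin n → Fin 2) ℂ)
    (Φ : Matrix (Fin n → Fin 2) (Fin n → Fin 2) ℂ →ₗ[ℂ] Matrix (Fin n → Fin 2) (Fin n → Fin 2) ℂ) :
    Matrix ((Fin n → Fin 2) × (Fin n → Fin 2)) ((Fin n → Fin 2) × (Fin n → Fin 2)) ℂ :=
  (1 / 4 ^ n : ℂ) • ∑ s : Fin n → Fin 4, ∑ t : Fin n → Fin 4,
    dichotomicCorrelator (pauliString s) (pauliString t) ρ Φ • (pauliString s ⊗ₖ pauliString t)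

variable {ι : Type*} [Fintype ι] [DecidableEq ι]

/-- A light-touch observable of modulus `l`: Hermitian, with all eigenvalues in `{l, -l}`. -/
def IsLightTouch (A : Matrix ι ι ℂ) (l : ℝ) : Prop :=
  A.IsHermitian ∧ 0 ≤ l ∧ A * A = ((l ^ 2 : ℝ) : ℂ) • (1 : Matrix ι ι ℂ)

/-- The two-time correlator of a light-touch observable `A` of modulus `l` (first time) and an
arbitrary observable `B` (second time): the system in state `ρ` is projected onto the eigenspace of
`A` with eigenvalue `ε l`, evolved by `Φ`, and `B` is measured.  For `l = 0`, so `A = 0`, the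
correlator is zero. -/
def lightTouchCorrelator (A : Matrix ι ι ℂ) (l : ℝ) (B ρ : Matrix ι ι ℂ)
    (Φ : Matrix ι ι ℂ →ₗ[ℂ] Matrix ι ι ℂ) : ℂ :=
  ∑ ε : ℤˣ, ((ε : ℤ) : ℂ) * (l : ℂ) *
    (B * Φ (signProj ((l : ℂ)⁻¹ • A) ε * ρ * signProj ((l : ℂ)⁻¹ • A) ε)).trace

/-- `R` is the pseudo-density matrix of a finite-dimensional system in state `ρ` evolving by `Φ`:
`Tr[R (A ⊗ B)] = ⟨{A, B}⟩` for all light-touch `A` and all observables `B`.  There is at most one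
such `R`, as light-touch observables span all matrices. -/
def IsPDM (ρ : Matrix ι ι ℂ) (Φ : Matrix ι ι ℂ →ₗ[ℂ] Matrix ι ι ℂ)
    (R : Matrix (ι × ι) (ι × ι) ℂ) : Prop :=
  ∀ (A : Matrix ι ι ℂ) (l : ℝ) (B : Matrix ι ι ℂ), IsLightTouch A l → B.IsHermitian →
    (R * (A ⊗ₖ B)).trace = lightTouchCorrelator A l B ρ Φ

/-- Spatial incompatibility: the pseudo-density matrix is not a density matrix. -/
def IsSpatiallyIncompatible (R : Matrix (ι × ι) (ι × ι) ℂ) : Prop :=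
  ¬ IsDensityMatrix R

/-- `W` is a witness that detects the spatial incompatibility of `R`: it is Hermitian, its
expectation is non-negative on all density matrices, and it is negative on `R`.  (The two traces are
real for Hermitian `σ` and `R`.) -/
def IsSIWitness (W R : Matrix (ι × ι) (ι × ι) ℂ) : Prop :=
  W.IsHermitian ∧ (∀ σ : Matrix (ι × ι) (ι × ι) ℂ, IsDensityMatrix σ → 0 ≤ (W * σ).trace.re) ∧
    (W * R).trace.re < 0

end PDM

end TemporalQuantum

end

namespace TemporalQuantum

open Matrix

/-! ### Choi positivity and off-diagonal matrix units -/

section Channels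

variable {ι : Type*} [Fintype ι] [DecidableEq ι]

/-! In the fixed basis, NCGD makes the populations obey Chapman–Kolmogorov (`map_map_single_apply`).
For incoherent `ρ` the three correlators are then averages over one law `p i * P i j * S j k` on
trajectories, and pointwise `q i * q j + q j * q k - q i * q k ≤ 1` (`leggettGarg_markov`).

For the second claim, a two-valued measurement of `A` enters the correlator only through the Jordan
product of `A` with `ρ` (`sum_signProj_conj`), so the PDM is a Choi-like matrix, `pseudoDensity`.
Take `ρ = |i⟩⟨i|` and `j ≠ i`: the diagonal block at `j` vanishes, while the block at `(i, j)` is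
half of `Φ(|j⟩⟨i|)`. Positivity would force the latter to vanish, yet a channel that is not OI keeps
some off-diagonal unit alive. A vector with negative expectation then yields the witness. -/

/-- The Choi matrix of a completely positive map is positive semidefinite. -/
theorem IsCompletelyPositive.posSemidef_choi {Φ : Matrix ι ι ℂ →ₗ[ℂ] Matrix ι ι ℂ}
    (hΦ : IsCompletelyPositive Φ) :
    (Matrix.of fun p q : ι × ι => Φ (single p.1 q.1 1) p.2 q.2).PosSemidef := by
  let e := (Fintype.equivFin ι).symm
  -- The unnormalised maximally entangled vector; the ampliation sends its projector to the Choi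
  -- matrix.
  let v : Fin (Fintype.card ι) × ι → ℂ := fun p => if e p.1 = p.2 then 1 else 0
  have h := (hΦ _ _ (posSemidef_vecMulVec_self_star v)).submatrix
    (fun p : ι × ι => (e.symm p.1, p.2))
  convert h using 1
  ext p q
  simp only [of_apply, submatrix_apply, ampliate]
  refine congrArg (fun Y => Φ Y p.2 q.2) ?_
  ext a b
  simp only [single_apply, of_apply, vecMulVec_apply, Pi.star_apply, v, Equiv.apply_symm_apply]
  by_cases h1 : p.1 = a <;> by_cases h2 : q.1 = b <;> simp [h1, h2]

theorem IsCompletelyPositive.star_map_single {Φ : Matrix ι ι ℂ →ₗ[ℂ] Matrix ι ι ℂ}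
    (hΦ : IsCompletelyPositive Φ) (a b x y : ι) :
    star (Φ (single a b 1) x y) = Φ (single b a 1) y x :=
  hΦ.posSemidef_choi.isHermitian.apply (b, y) (a, x)

theorem IsCompletelyPositive.map_single_nonneg {Φ : Matrix ι ι ℂ →ₗ[ℂ] Matrix ι ι ℂ}
    (hΦ : IsCompletelyPositive Φ) (a x : ι) : 0 ≤ Φ (single a a 1) x x :=
  hΦ.posSemidef_choi.diag_nonneg (i := (a, x))

theorem map_diagonal_apply (Φ : Matrix ι ι ℂ →ₗ[ℂ] Matrix ι ι ℂ) (d : ι → ℂ) (x y : ι) :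
    Φ (diagonal d) x y = ∑ i, d i * Φ (single i i 1) x y := by
  have h : diagonal d = ∑ i, d i • single i i (1 : ℂ) := by
    simp only [smul_single, smul_eq_mul, mul_one, sum_single_eq_diagonal]
  simp only [h, map_sum, map_smul, Matrix.sum_apply, Matrix.smul_apply, smul_eq_mul]

/-- A map which annihilates all off-diagonal matrix units is off-diagonal independent. -/
theorem exists_map_single_ne_zero {Φ : Matrix ι ι ℂ →ₗ[ℂ] Matrix ι ι ℂ}
    (hΦ : ¬ IsOffDiagonalIndependent Φ) : ∃ i j, i ≠ j ∧ Φ (single j i 1) ≠ 0 := by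
  contrapose! hΦ
  refine Matrix.ext_linearMap _ fun i j => LinearMap.ext_ring ?_
  simp only [LinearMap.comp_apply, singleLinearMap_apply]
  by_cases hij : i = j
  · subst hij
    congr 1
    ext a b
    simp only [decohere, LinearMap.coe_mk, AddHom.coe_mk, diagonal_apply, diag_apply, single_apply]
    by_cases hab : a = b
    · subst hab; simp
    · rw [if_neg hab, if_neg (by rintro ⟨rfl, rfl⟩; exact hab rfl)]
  · rw [hΦ j i (Ne.symm hij)]
    have : decohere (single i j (1 : ℂ)) = 0 := by
      ext a b
      simp only [decohere, LinearMap.coe_mk, AddHom.coe_mk, diagonal_apply, diag_apply,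
        single_apply, Matrix.zero_apply]
      by_cases hab : a = b
      · rw [if_pos hab, if_neg (by rintro ⟨rfl, rfl⟩; exact hij rfl)]
      · rw [if_neg hab]
    rw [this, map_zero]

end Channels

/-! ### Classical Markov chains and the Leggett–Garg inequality -/

section LeggettGarg

variable {ι : Type*} [Fintype ι]

/-- The Leggett–Garg inequality for a classical Markov chain with initial distribution `p` and
transition probabilities `P` and `S`. -/
theorem leggettGarg_markov {p : ι → ℝ} {P S : ι → ι → ℝ} {q : ι → ℝ}
    (hp : ∀ i, 0 ≤ p i) (hP : ∀ i j, 0 ≤ P i j) (hS : ∀ i j, 0 ≤ S i j)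
    (hp1 : ∑ i, p i = 1) (hP1 : ∀ i, ∑ j, P i j = 1) (hS1 : ∀ i, ∑ j, S i j = 1)
    (hq : ∀ i, q i = 1 ∨ q i = -1) :
    (∑ i, ∑ j, q i * q j * (p i * P i j)) + (∑ j, ∑ k, q j * q k * ((∑ i, p i * P i j) * S j k))
      - ∑ i, ∑ k, q i * q k * (p i * ∑ j, P i j * S j k) ≤ 1 := by
  have h1 : ∑ i, ∑ j, q i * q j * (p i * P i j)
      = ∑ i, ∑ j, ∑ k, q i * q j * (p i * P i j * S j k) := by
    refine Finset.sum_congr rfl fun i _ => Finset.sum_congr rfl fun j _ => ?_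
    rw [← Finset.mul_sum, ← Finset.mul_sum, hS1, mul_one]
  have h2 : ∑ j, ∑ k, q j * q k * ((∑ i, p i * P i j) * S j k)
      = ∑ i, ∑ j, ∑ k, q j * q k * (p i * P i j * S j k) := by
    rw [Finset.sum_comm (f := fun i j => ∑ k, q j * q k * (p i * P i j * S j k))]
    refine Finset.sum_congr rfl fun j _ => ?_
    rw [Finset.sum_comm]
    refine Finset.sum_congr rfl fun k _ => ?_
    rw [Finset.sum_mul, Finset.mul_sum]
  have h3 : ∑ i, ∑ k, q i * q k * (p i * ∑ j, P i j * S j k)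
      = ∑ i, ∑ j, ∑ k, q i * q k * (p i * P i j * S j k) := by
    refine Finset.sum_congr rfl fun i _ => ?_
    rw [Finset.sum_comm]
    refine Finset.sum_congr rfl fun k _ => ?_
    simp only [Finset.mul_sum, mul_assoc]
  have h4 : ∑ i, ∑ j, ∑ k, p i * P i j * S j k = 1 := by
    simp only [← Finset.mul_sum, hS1, mul_one, hP1, hp1]
  rw [h1, h2, h3, ← h4]
  simp only [← Finset.sum_add_distrib, ← Finset.sum_sub_distrib]
  refine Finset.sum_le_sum fun i _ => Finset.sum_le_sum fun j _ => Finset.sum_le_sum fun k _ => ?_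
  -- For signs this expression is always `1` or `-3`.
  have h5 : q i * q j + q j * q k - q i * q k ≤ 1 := by
    rcases hq i with hi | hi <;> rcases hq j with hj | hj <;> rcases hq k with hk | hk <;>
      rw [hi, hj, hk] <;> norm_num
  have h6 : 0 ≤ p i * P i j * S j k := mul_nonneg (mul_nonneg (hp i) (hP i j)) (hS j k)
  nlinarith

variable [DecidableEq ι]

theorem basisCorrelator_eq (q : ι → ℝ) (σ : Matrix ι ι ℂ) {Φ : Matrix ι ι ℂ →ₗ[ℂ] Matrix ι ι ℂ}
    (hΦ : IsCompletelyPositive Φ) :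
    basisCorrelator q σ Φ
      = ∑ i, ∑ j, q i * q j * ((σ i i).re * (Φ (single i i 1) j j).re) := by
  refine Finset.sum_congr rfl fun i _ => Finset.sum_congr rfl fun j _ => ?_
  have h : basisProj i * σ * basisProj i = σ i i • single i i (1 : ℂ) := by
    simp [basisProj, single_mul_mul_single]
  rw [h, map_smul]
  have him : (Φ (single i i 1) j j).im = 0 := (Complex.le_def.mp (hΦ.map_single_nonneg i j)).2.symm
  simp [basisProj, trace_single_mul, Complex.mul_re, him]

theorem IsChannel.sum_map_single_re {Φ : Matrix ι ι ℂ →ₗ[ℂ] Matrix ι ι ℂ} (hΦ : IsChannel Φ)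
    (i : ι) : ∑ j, (Φ (single i i 1) j j).re = 1 := by
  have h := hΦ.2 (single i i 1)
  rw [trace_single_eq_same] at h
  rw [← Complex.re_sum]
  exact congrArg Complex.re h

/-- NCGD channels obey the Chapman–Kolmogorov equation in the fixed basis. -/
theorem map_map_single_apply {Φ Ψ : Matrix ι ι ℂ →ₗ[ℂ] Matrix ι ι ℂ}
    (h : decohere ∘ₗ Ψ ∘ₗ decohere ∘ₗ Φ ∘ₗ decohere = decohere ∘ₗ (Ψ ∘ₗ Φ) ∘ₗ decohere)
    (i k : ι) :
    Ψ (Φ (single i i 1)) k k = ∑ j, Φ (single i i 1) j j * Ψ (single j j 1) k k := by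
  have hd : decohere (single i i (1 : ℂ)) = single i i 1 := by
    ext a b
    simp only [decohere, LinearMap.coe_mk, AddHom.coe_mk, diagonal_apply, diag_apply, single_apply]
    by_cases hab : a = b
    · subst hab; simp
    · rw [if_neg hab, if_neg (by rintro ⟨rfl, rfl⟩; exact hab rfl)]
  have h' := congrFun (congrFun (LinearMap.congr_fun h (single i i 1)) k) k
  simp only [LinearMap.comp_apply, hd] at h'
  simp only [decohere, LinearMap.coe_mk, AddHom.coe_mk, diagonal_apply_eq, diag_apply,
    map_diagonal_apply] at h'
  exact h'.symm

theorem leggettGargInequality_of_ncgd {Φ Ψ : Matrix ι ι ℂ →ₗ[ℂ] Matrix ι ι ℂ} (hΦ : IsChannel Φ)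
    (hΨ : IsChannel Ψ) (hΨΦ : IsChannel (Ψ ∘ₗ Φ))
    (h : decohere ∘ₗ Ψ ∘ₗ decohere ∘ₗ Φ ∘ₗ decohere = decohere ∘ₗ (Ψ ∘ₗ Φ) ∘ₗ decohere)
    {ρ : Matrix ι ι ℂ} (hρ : IsIncoherentState ρ) {q : ι → ℝ} (hq : ∀ i, q i = 1 ∨ q i = -1) :
    LeggettGargInequality q ρ Φ Ψ := by
  have hre : ∀ {Θ : Matrix ι ι ℂ →ₗ[ℂ] Matrix ι ι ℂ}, IsChannel Θ → ∀ (z : ℂ) (i j : ι),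
      (z * Θ (single i i 1) j j).re = z.re * (Θ (single i i 1) j j).re := by
    intro Θ hΘ z i j
    have him : (Θ (single i i 1) j j).im = 0 :=
      (Complex.le_def.mp (hΘ.1.map_single_nonneg i j)).2.symm
    simp [Complex.mul_re, him]
  have hpos : ∀ {Θ : Matrix ι ι ℂ →ₗ[ℂ] Matrix ι ι ℂ}, IsChannel Θ → ∀ i j : ι,
      0 ≤ (Θ (single i i 1) j j).re :=
    fun hΘ i j => (Complex.le_def.mp (hΘ.1.map_single_nonneg i j)).1
  -- Nothing is measured at the first time for `C₂₃`; diagonality of `ρ` still makes the later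
  -- populations those of the chain.
  have hmid : ∀ j, (Φ ρ j j).re = ∑ i, (ρ i i).re * (Φ (single i i 1) j j).re := by
    intro j
    rw [← hρ.2.diagonal_diag, map_diagonal_apply, Complex.re_sum]
    simp only [hre hΦ, diag_apply, diagonal_apply_eq]
  have hcomp : ∀ i k, ((Ψ ∘ₗ Φ) (single i i 1) k k).re
      = ∑ j, (Φ (single i i 1) j j).re * (Ψ (single j j 1) k k).re := by
    intro i k
    rw [LinearMap.comp_apply, map_map_single_apply h, Complex.re_sum]
    simp only [hre hΨ]
  have htr : ∑ i, (ρ i i).re = 1 := by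
    rw [← Complex.re_sum]
    exact congrArg Complex.re hρ.1.2
  rw [LeggettGargInequality, basisCorrelator_eq q ρ hΦ.1, basisCorrelator_eq q (Φ ρ) hΨ.1,
    basisCorrelator_eq q ρ hΨΦ.1]
  simp only [hmid, hcomp]
  exact leggettGarg_markov (fun i => (Complex.le_def.mp hρ.1.1.diag_nonneg).1) (hpos hΦ) (hpos hΨ)
    htr hΦ.sum_map_single_re hΨ.sum_map_single_re hq

theorem Dynamics.IsNCGD.leggettGargInequality {T : Type*} [AddCommSemigroup T]
    {Λ : Dynamics T ι} (hΛ : Λ.IsNCGD) {ρ : Matrix ι ι ℂ} (hρ : IsIncoherentState ρ) {q : ι → ℝ}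
    (hq : ∀ i, q i = 1 ∨ q i = -1) (τ t : T) :
    LeggettGargInequality q ρ (Λ.evolve τ) (Λ.evolve t) := by
  have h := hΛ t τ
  have hc := Λ.isChannel (t + τ)
  rw [Λ.evolve_add] at h hc
  exact leggettGargInequality_of_ncgd (Λ.isChannel τ) (Λ.isChannel t) hc h hρ hq

end LeggettGarg

/-! ### Closed form of the pseudo-density matrix -/

section PDM

variable {ι : Type*} [Fintype ι] [DecidableEq ι]

/-- The Jordan product `(A ρ + ρ A) / 2` with `ρ`, as a linear map. -/
noncomputable def jordanMul (ρ : Matrix ι ι ℂ) : Matrix ι ι ℂ →ₗ[ℂ] Matrix ι ι ℂ :=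
  (1 / 2 : ℂ) • (LinearMap.mulRight ℂ ρ + LinearMap.mulLeft ℂ ρ)

theorem jordanMul_apply (ρ A : Matrix ι ι ℂ) :
    jordanMul ρ A = (1 / 2 : ℂ) • (A * ρ + ρ * A) := by
  simp [jordanMul]

/-- The matrix `R` with `Tr[R (A ⊗ B)] = Tr[B Φ((A ρ + ρ A) / 2)]` for all `A` and `B`. -/
noncomputable def pseudoDensity (ρ : Matrix ι ι ℂ) (Φ : Matrix ι ι ℂ →ₗ[ℂ] Matrix ι ι ℂ) :
    Matrix (ι × ι) (ι × ι) ℂ :=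
  Matrix.of fun p q => Φ (jordanMul ρ (single q.1 p.1 1)) p.2 q.2

theorem trace_pseudoDensity_mul_kronecker (ρ : Matrix ι ι ℂ)
    (Φ : Matrix ι ι ℂ →ₗ[ℂ] Matrix ι ι ℂ) (A B : Matrix ι ι ℂ) :
    (pseudoDensity ρ Φ * (A ⊗ₖ B)).trace = (B * Φ (jordanMul ρ A)).trace := by
  have hA : ∀ x y, Φ (jordanMul ρ A) x y
      = ∑ a, ∑ b, A a b * Φ (jordanMul ρ (single a b 1)) x y := by
    intro x y
    conv_lhs => rw [matrix_eq_sum_single A]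
    simp only [map_sum, Matrix.sum_apply]
    refine Finset.sum_congr rfl fun a _ => Finset.sum_congr rfl fun b _ => ?_
    rw [show single a b (A a b) = A a b • single a b (1 : ℂ) by simp [smul_single],
      map_smul, map_smul, Matrix.smul_apply, smul_eq_mul]
  simp only [trace, diag_apply, mul_apply, Fintype.sum_prod_type, kroneckerMap_apply,
    pseudoDensity, of_apply, hA, Finset.mul_sum]
  calc ∑ b, ∑ x, ∑ a, ∑ y, Φ (jordanMul ρ (single a b 1)) x y * (A a b * B y x)
      = ∑ y, ∑ x, ∑ a, ∑ b, Φ (jordanMul ρ (single a b 1)) x y * (A a b * B y x) := by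
        rw [Finset.sum_comm]
        conv_rhs => rw [Finset.sum_comm]
        refine Finset.sum_congr rfl fun x _ => ?_
        rw [Finset.sum_comm]
        conv_rhs => rw [Finset.sum_comm]
        exact Finset.sum_congr rfl fun a _ => Finset.sum_comm
    _ = _ := by
        refine Finset.sum_congr rfl fun y _ => Finset.sum_congr rfl fun x _ =>
          Finset.sum_congr rfl fun a _ => Finset.sum_congr rfl fun b _ => by ring

theorem sum_intUnits {M : Type*} [AddCommMonoid M] (f : ℤˣ → M) :
    ∑ ε, f ε = f 1 + f (-1) := by
  rw [UnitsInt.univ, Finset.sum_pair (by decide)]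

/-- The terms `ρ` and `A * ρ * A` do not change with `ε`, so the weighted sum cancels them and keeps
the cross terms. -/
theorem sum_signProj_conj (A ρ : Matrix ι ι ℂ) :
    ∑ ε : ℤˣ, ((ε : ℤ) : ℂ) • (signProj A ε * ρ * signProj A ε) = jordanMul ρ A := by
  rw [jordanMul_apply, sum_intUnits]
  simp only [signProj, Units.val_one, Units.val_neg, Int.cast_one, Int.cast_neg, one_smul, neg_smul,
    smul_mul_assoc, mul_smul_comm, mul_add, add_mul, mul_one, one_mul, mul_neg, neg_mul]
  module

theorem dichotomicCorrelator_eq (A B ρ : Matrix ι ι ℂ) (Φ : Matrix ι ι ℂ →ₗ[ℂ] Matrix ι ι ℂ) :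
    dichotomicCorrelator A B ρ Φ = (B * Φ (jordanMul ρ A)).trace := by
  have hB : ∑ δ : ℤˣ, ((δ : ℤ) : ℂ) • signProj B δ = B := by
    rw [sum_intUnits]
    simp only [signProj, Units.val_one, Units.val_neg, Int.cast_one, Int.cast_neg]
    module
  rw [← sum_signProj_conj, dichotomicCorrelator]
  conv_rhs => rw [← hB]
  simp only [map_sum, map_smul, Finset.sum_mul, Finset.mul_sum, smul_mul_assoc, mul_smul_comm,
    trace_sum, trace_smul, smul_eq_mul, mul_assoc]

theorem isPDM_pseudoDensity (ρ : Matrix ι ι ℂ) (Φ : Matrix ι ι ℂ →ₗ[ℂ] Matrix ι ι ℂ) :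
    IsPDM ρ Φ (pseudoDensity ρ Φ) := by
  intro A l B hA _
  rw [trace_pseudoDensity_mul_kronecker]
  have h : lightTouchCorrelator A l B ρ Φ
      = (l : ℂ) * (B * Φ (jordanMul ρ ((l : ℂ)⁻¹ • A))).trace := by
    rw [← sum_signProj_conj, lightTouchCorrelator]
    simp only [map_sum, map_smul, Finset.mul_sum, mul_smul_comm, trace_sum, trace_smul,
      smul_eq_mul]
    exact Finset.sum_congr rfl fun ε _ => by ring
  rw [h]
  -- For `l = 0`, `A * A = 0` with `A` Hermitian gives `A = 0`; otherwise linearity cancels `l`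
  -- against its inverse.
  by_cases hl : l = 0
  · have hA0 : A = 0 := by
      have h2 := hA.2.2
      rw [hl] at h2
      apply conjTranspose_mul_self_eq_zero.mp
      rw [hA.1.eq, h2]
      simp
    simp [hl, hA0]
  · have hl' : (l : ℂ) ≠ 0 := by exact_mod_cast hl
    simp [hl']

/-- Completeness of the Pauli strings. -/
theorem sum_pauliString_mul {n : ℕ} (a b c d : Fin n → Fin 2) :
    ∑ s : Fin n → Fin 4, pauliString s a b * pauliString s c d
      = if a = d ∧ b = c then 2 ^ n else 0 := by
  have hp : ∀ a b c d : Fin 2, ∑ s, pauli s a b * pauli s c d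
      = if a = d ∧ b = c then 2 else 0 := by
    intro a b c d
    fin_cases a <;> fin_cases b <;> fin_cases c <;> fin_cases d <;>
      simp [Fin.sum_univ_four, pauli] <;> norm_num
  have h : ∑ s : Fin n → Fin 4, pauliString s a b * pauliString s c d
      = ∏ k, ∑ s, pauli s (a k) (b k) * pauli s (c k) (d k) := by
    rw [Finset.prod_univ_sum, Fintype.piFinset_univ]
    simp [pauliString, Finset.prod_mul_distrib]
  rw [h]
  simp only [hp]
  split_ifs with hc
  · obtain ⟨rfl, rfl⟩ := hc
    simp
  · obtain ⟨k, hk⟩ : ∃ k, ¬ (a k = d k ∧ b k = c k) := by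
      contrapose! hc
      exact ⟨funext fun k => (hc k).1, funext fun k => (hc k).2⟩
    exact Finset.prod_eq_zero (Finset.mem_univ k) (if_neg hk)

/-- Pauli completeness in each tensor factor selects one matrix entry, and its two factors `2 ^ n`
cancel the prefactor. -/
theorem pauliPDM_eq {n : ℕ} (ρ : Matrix (Fin n → Fin 2) (Fin n → Fin 2) ℂ)
    (Φ : Matrix (Fin n → Fin 2) (Fin n → Fin 2) ℂ →ₗ[ℂ]
      Matrix (Fin n → Fin 2) (Fin n → Fin 2) ℂ) :
    pauliPDM ρ Φ = pseudoDensity ρ Φ := by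
  set M := pseudoDensity ρ Φ
  ext x y
  have hcorr : ∀ s t : Fin n → Fin 4, dichotomicCorrelator (pauliString s) (pauliString t) ρ Φ
      = ∑ p, ∑ r, M p r * (pauliString s r.1 p.1 * pauliString t r.2 p.2) := by
    intro s t
    rw [dichotomicCorrelator_eq, ← trace_pseudoDensity_mul_kronecker]
    rfl
  have h : ∑ s : Fin n → Fin 4, ∑ t : Fin n → Fin 4,
      dichotomicCorrelator (pauliString s) (pauliString t) ρ Φ
        * (pauliString s x.1 y.1 * pauliString t x.2 y.2) = 4 ^ n * M x y := by
    calc _ = ∑ p, ∑ r, M p r * ((∑ s : Fin n → Fin 4, pauliString s r.1 p.1 * pauliString s x.1 y.1)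
            * ∑ t : Fin n → Fin 4, pauliString t r.2 p.2 * pauliString t x.2 y.2) := by
          simp only [hcorr, Finset.sum_mul, Finset.mul_sum]
          refine (Finset.sum_congr rfl fun s _ => Finset.sum_comm.trans
            (Finset.sum_congr rfl fun p _ => Finset.sum_comm)).trans (Finset.sum_comm.trans
            (Finset.sum_congr rfl fun p _ => Finset.sum_comm.trans ?_))
          refine Finset.sum_congr rfl fun r _ => Finset.sum_comm.trans
            (Finset.sum_congr rfl fun t _ => Finset.sum_congr rfl fun s _ => by ring)
      _ = _ := by
          simp only [sum_pauliString_mul]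
          rw [Finset.sum_eq_single x, Finset.sum_eq_single y]
          · simp only [and_self, if_true]
            rw [← mul_pow]; norm_num [mul_comm]
          · intro r _ hr
            by_cases h1 : r.1 = y.1
            · have h2 : r.2 ≠ y.2 := fun h2 => hr (Prod.ext h1 h2)
              simp [h2]
            · simp [h1]
          · simp
          · intro p _ hp
            refine Finset.sum_eq_zero fun r _ => ?_
            by_cases h1 : p.1 = x.1
            · have h2 : p.2 ≠ x.2 := fun h2 => hp (Prod.ext h1 h2)
              simp [h2]
            · simp [h1]
          · simp
  have h4 : (4 : ℂ) ^ n ≠ 0 := by positivity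
  simp only [pauliPDM, Matrix.smul_apply, Matrix.sum_apply, kroneckerMap_apply, smul_eq_mul]
  rw [h]
  field_simp

/-! ### Failure of positivity and witnesses -/

theorem jordanMul_single {ρ : Matrix ι ι ℂ} (hρ : ρ.IsDiag) (a b : ι) :
    jordanMul ρ (single a b 1) = ((ρ a a + ρ b b) / 2) • single a b (1 : ℂ) := by
  rw [jordanMul_apply]
  conv_lhs => rw [← hρ.diagonal_diag]
  ext i j
  simp only [Matrix.smul_apply, Matrix.add_apply, mul_diagonal, diagonal_mul, single_apply,
    diag_apply, smul_eq_mul]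
  split_ifs with h
  · rw [← h.1, ← h.2]; ring
  · ring

/-- The Jordan weight `(ρ a a + ρ b b) / 2` is real and symmetric in `a` and `b`, and `Φ` preserves
adjoints. -/
theorem pseudoDensity_isHermitian {ρ : Matrix ι ι ℂ} (hρ : IsIncoherentState ρ)
    {Φ : Matrix ι ι ℂ →ₗ[ℂ] Matrix ι ι ℂ} (hΦ : IsCompletelyPositive Φ) :
    (pseudoDensity ρ Φ).IsHermitian := by
  have hre : ∀ i, star (ρ i i) = ρ i i := fun i => hρ.1.1.isHermitian.apply i i
  refine IsHermitian.ext fun p q => ?_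
  simp only [pseudoDensity, of_apply, jordanMul_single hρ.2, map_smul, Matrix.smul_apply,
    smul_eq_mul, star_mul', hΦ.star_map_single, star_div₀, star_add, hre, star_ofNat,
    add_comm (ρ q.1 q.1)]

theorem isIncoherentState_basisProj (i : ι) : IsIncoherentState (basisProj i) := by
  have h : basisProj i = diagonal (Pi.single i (1 : ℂ)) := (diagonal_single i 1).symm
  refine ⟨⟨?_, trace_single_eq_same i 1⟩, ?_⟩
  · rw [h, posSemidef_diagonal_iff]
    intro j
    by_cases hj : j = i
    · subst hj; simp
    · simp [hj]
  · rw [h]; exact isDiag_diagonal _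

theorem not_posSemidef_pseudoDensity {Φ : Matrix ι ι ℂ →ₗ[ℂ] Matrix ι ι ℂ} {i j : ι} (hij : i ≠ j)
    (hΦ : Φ (single j i 1) ≠ 0) : ¬ (pseudoDensity (basisProj i) Φ).PosSemidef := by
  intro h
  apply hΦ
  ext x y
  have h0 : pseudoDensity (basisProj i) Φ (j, y) (j, y) = 0 := by
    simp [pseudoDensity, jordanMul_apply, basisProj, hij, hij.symm]
  have h1 : pseudoDensity (basisProj i) Φ (i, x) (j, y) = (1 / 2) * Φ (single j i 1) x y := by
    simp [pseudoDensity, jordanMul_apply, basisProj, hij]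
  -- A zero diagonal entry of a positive semidefinite matrix annihilates its whole column.
  have h2 := (h.dotProduct_mulVec_zero_iff (Pi.single (j, y) 1)).mp (by simp [h0])
  have h3 := congrFun h2 (i, x)
  simpa [h1] using h3

theorem exists_witness {R : Matrix (ι × ι) (ι × ι) ℂ} (hR : R.IsHermitian)
    (h : ¬ R.PosSemidef) : ∃ W, IsSIWitness W R := by
  obtain ⟨v, hv⟩ : ∃ v : ι × ι → ℂ, ¬ 0 ≤ star v ⬝ᵥ (R *ᵥ v) := by
    contrapose! h
    exact PosSemidef.of_dotProduct_mulVec_nonneg hR h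
  have htr : ∀ X : Matrix (ι × ι) (ι × ι) ℂ,
      (vecMulVec v (star v) * X).trace = star v ⬝ᵥ (X *ᵥ v) := by
    intro X
    rw [vecMulVec_mul, trace_vecMulVec, dotProduct_comm, dotProduct_mulVec]
  refine ⟨vecMulVec v (star v), (posSemidef_vecMulVec_self_star v).isHermitian, ?_, ?_⟩
  · intro σ hσ
    rw [htr]
    exact (Complex.le_def.mp (hσ.1.dotProduct_mulVec_nonneg v)).1
  · rw [htr]
    by_contra hneg
    -- The complex order also demands zero imaginary part, which Hermiticity of `R` supplies.
    refine hv (Complex.le_def.mpr ⟨not_lt.mp hneg, ?_⟩)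
    have : star (star v ⬝ᵥ (R *ᵥ v)) = star v ⬝ᵥ (R *ᵥ v) := by
      rw [← star_dotProduct_star, star_star, star_mulVec, hR.eq, dotProduct_mulVec,
        dotProduct_comm]
    exact (Complex.conj_eq_iff_im.mp this).symm

/-- A channel which is not off-diagonal independent has a spatially incompatible pseudo-density
matrix for some incoherent input. -/
theorem exists_incompatible_pseudoDensity {Φ : Matrix ι ι ℂ →ₗ[ℂ] Matrix ι ι ℂ} (hΦ : IsChannel Φ)
    (h : ¬ IsOffDiagonalIndependent Φ) :
    ∃ ρ, IsIncoherentState ρ ∧ IsSpatiallyIncompatible (pseudoDensity ρ Φ) ∧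
      ∃ W, IsSIWitness W (pseudoDensity ρ Φ) := by
  obtain ⟨i, j, hij, hne⟩ := exists_map_single_ne_zero h
  have hR := not_posSemidef_pseudoDensity hij hne
  exact ⟨basisProj i, isIncoherentState_basisProj i, fun hd => hR hd.1,
    exists_witness (pseudoDensity_isHermitian (isIncoherentState_basisProj i) hΦ.1) hR⟩

end PDM

end TemporalQuantum

theorem proposition6 {T : Type*} [AddCommSemigroup T] :
    -- systems of `n` qubits
    (∀ (n : ℕ) (Λ : TemporalQuantum.Dynamics T (Fin n → Fin 2)), Λ.IsNCGD →
      (∀ ρ, TemporalQuantum.IsIncoherentState ρ →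
        ∀ q : (Fin n → Fin 2) → ℝ, (∀ i, q i = 1 ∨ q i = -1) →
          ∀ τ t : T, TemporalQuantum.LeggettGargInequality q ρ (Λ.evolve τ) (Λ.evolve t)) ∧
      (∀ t : T, ¬ TemporalQuantum.IsOffDiagonalIndependent (Λ.evolve t) →
        ∃ ρ, TemporalQuantum.IsIncoherentState ρ ∧
          TemporalQuantum.IsSpatiallyIncompatible (TemporalQuantum.pauliPDM ρ (Λ.evolve t)) ∧
          ∃ W, TemporalQuantum.IsSIWitness W (TemporalQuantum.pauliPDM ρ (Λ.evolve t)))) ∧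
    -- systems of arbitrary finite dimension
    (∀ (d : ℕ) (Λ : TemporalQuantum.Dynamics T (Fin d)), Λ.IsNCGD →
      (∀ ρ, TemporalQuantum.IsIncoherentState ρ →
        ∀ q : Fin d → ℝ, (∀ i, q i = 1 ∨ q i = -1) →
          ∀ τ t : T, TemporalQuantum.LeggettGargInequality q ρ (Λ.evolve τ) (Λ.evolve t)) ∧
      (∀ t : T, ¬ TemporalQuantum.IsOffDiagonalIndependent (Λ.evolve t) →
        ∃ ρ, TemporalQuantum.IsIncoherentState ρ ∧
          ∃ R, TemporalQuantum.IsPDM ρ (Λ.evolve t) R ∧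
            TemporalQuantum.IsSpatiallyIncompatible R ∧
            ∃ W, TemporalQuantum.IsSIWitness W R)) := by
  refine ⟨fun n Λ hΛ => ⟨fun ρ hρ q hq τ t => hΛ.leggettGargInequality hρ hq τ t, fun t ht => ?_⟩,
    fun d Λ hΛ => ⟨fun ρ hρ q hq τ t => hΛ.leggettGargInequality hρ hq τ t, fun t ht => ?_⟩⟩
  · simp only [TemporalQuantum.pauliPDM_eq]
    exact TemporalQuantum.exists_incompatible_pseudoDensity (Λ.isChannel t) ht
  · obtain ⟨ρ, hρ, hR, hW⟩ :=
      TemporalQuantum.exists_incompatible_pseudoDensity (Λ.isChannel t) ht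
    exact ⟨ρ, hρ, _, TemporalQuantum.isPDM_pseudoDensity ρ _, hR, hW⟩
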